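/- **Setting (one iteration of a mediated semi-quantum key distribution protocol, collective attack).** Write $|\phi_0\rangle,|\phi_1\rangle=\frac{1}{\sqrt2}(|00\rangle\pm|11\rangle)$ and $|\phi_2\rangle,|\phi_3\rangle=\frac{1}{\sqrt2}(|01\rangle\pm|10\rangle)$ for the Bell states of two qubits $T_A,T_B$. An adversarial server $C$, with a finite-dimensional private ancilla $\mathcal H_C$ and a two-dimensional message register $\mathcal H_{cl}$ with orthonormal basis $|{+1}\rangle,|{-1}\rangle$, sends an arbitrary two-qubit state $\rho_0$ (pure or mixed), one qubit to $A$ and one to $B$. In the iterations considered, $A$ and $B$ both measure in the computational basis and resend their result; $p_{ij}=\langle ij|\rho_0|ij\rangle$ is the probability that they measure $|i,j\rangle$, and $i$ is $A$'s raw key bit. The server then applies a unitary $U$ to $T_A\otimes T_B\otimes\mathcal H_C\otimes\mathcal H_{cl}$, with $\mathcal H_C$ and $\mathcal H_{cl}$ initially in fixed normalized states $|0\rangle_C$, $|0\rangle_{cl}$, and measures $\mathcal H_{cl}$; the outcome is the announced message. Define $|e_i\rangle,|f_i\rangle\in T_A\otimes T_B\otimes\mathcal H_C$ by $$U\big(|\phi_i\rangle|0\rangle_C|0\rangle_{cl}\big)=|e_i\rangle|{+1}\rangle+|f_i\rangle|{-1}\rangle,\qquad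 i=0,1,2,3.$$ Let $p_a$ be the probability that $C$ announces "$-1$" given that $A$ and $B$ both measured, and assume $p_a>0$. Let $\rho'_{ABC}$ be the state of $A$'s and $B$'s classical registers and $C$'s system $T_A\otimes T_B\otimes\mathcal H_C$ obtained from $\sum_{i,j}p_{ij}|ij\rangle\langle ij|_{AB}\otimes U|ij\rangle\langle ij|U^*$ by projecting $\mathcal H_{cl}$ onto $|{-1}\rangle$ and normalizing (here $U|ij\rangle$ abbreviates $U(|ij\rangle|0\rangle_C|0\rangle_{cl})$), let $\rho'_{AC}$ be its partial trace over $B$, and let $I(A:C)=S(\rho'_A)+S(\rho'_C)-S(\rho'_{AC})$, where $S$ is the von Neumann entropy with logarithms to base $2$. **Theorem 1.** Assume the attack is symmetric: for some real $Q$, $p_{00}=p_{11}=\frac{1-Q}{2}$ and $p_{01}=p_{10}=\frac{Q}{2}$; the probability that $C$ announces "$-1$" given that $A$ and $B$ measured $|0,0\rangle$ equals that given $|1,1\rangle$; and the probability that $C$ announces "$-1$" given $|0,1\rangle$ equals that given $|1,0\rangle$ (each of the last two conditions is void if the events in it have probability zero). Then $$I(A:C)\le\frac{1-Q}{p_a}\sqrt{\langle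 f_0|f_0\rangle\langle f_1|f_1\rangle}+\frac{Q}{p_a}\sqrt{\langle f_2|f_2\rangle\langle f_3|f_3\rangle}.$$ Moreover $\langle f_i|f_i\rangle\le1$ for all $i$, and the right-hand side above is at most $\frac{1-Q}{p_a}\sqrt{\langle f_0|f_0\rangle}+\frac{Q}{p_a}$. -/

import Mathlib

open scoped Matrix Kronecker ComplexOrder

noncomputable section

namespace MediatedSQKD

/-- `⟨v|w⟩` on `ℂⁿ`, conjugate-linear in the first argument. -/
def braket {n : Type*} [Fintype n] (v w : n → ℂ) : ℂ := star v ⬝ᵥ w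

/-- The standard basis vector `|a⟩`. -/
def ket {n : Type*} [DecidableEq n] (a : n) : n → ℂ := Pi.single a 1

/-- The tensor product of two vectors, in coordinates. -/
def tens {m n : Type*} (v : m → ℂ) (w : n → ℂ) : m × n → ℂ := fun x => v x.1 * w x.2

/-- The operator `P(v) = |v⟩⟨v|`. -/
def ketbra {n : Type*} (v : n → ℂ) : Matrix n n ℂ := Matrix.vecMulVec v (star v)

/-- Trace out the second tensor factor. -/
def traceSnd {m n : Type*} [Fintype n] (ρ : Matrix (m × n) (m × n) ℂ) : Matrix m m ℂ :=
  fun a a' => ∑ b, ρ (a, b) (a', b)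

/-- Trace out the first tensor factor. -/
def traceFst {m n : Type*} [Fintype m] (ρ : Matrix (m × n) (m × n) ℂ) : Matrix n n ℂ :=
  fun b b' => ∑ a, ρ (a, b) (a, b')

open Classical in
/-- The von Neumann entropy in bits, `S(ρ) = -∑ λᵢ log₂ λᵢ` over the eigenvalues of the Hermitian
matrix `ρ` (with `0 log 0 = 0`); the value `0` for non-Hermitian matrices is never used. -/
def vonNeumannEntropy {n : Type*} [Fintype n] [DecidableEq n] (ρ : Matrix n n ℂ) : ℝ :=
  if h : ρ.IsHermitian then -∑ i, h.eigenvalues i * Real.logb 2 (h.eigenvalues i) else 0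

/-- The quantum mutual information `S(ρ_X) + S(ρ_Y) - S(ρ_XY)` of a bipartite state. -/
def mutualInformation {m n : Type*} [Fintype m] [Fintype n] [DecidableEq m] [DecidableEq n]
    (ρ : Matrix (m × n) (m × n) ℂ) : ℝ :=
  vonNeumannEntropy (traceSnd ρ) + vonNeumannEntropy (traceFst ρ) - vonNeumannEntropy ρ

/-- The Bell states `Φ⁺, Φ⁻, Ψ⁺, Ψ⁻` (in this order) of the two qubits `T_A`, `T_B`. -/
def bell : Fin 4 → (Fin 2 × Fin 2 → ℂ) :=
  ![((1 / Real.sqrt 2 : ℝ) : ℂ) • (ket (0, 0) + ket (1, 1)),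
    ((1 / Real.sqrt 2 : ℝ) : ℂ) • (ket (0, 0) - ket (1, 1)),
    ((1 / Real.sqrt 2 : ℝ) : ℂ) • (ket (0, 1) + ket (1, 0)),
    ((1 / Real.sqrt 2 : ℝ) : ℂ) • (ket (0, 1) - ket (1, 0))]

/-- Basis labels of `T_A ⊗ T_B ⊗ C`, the quantum system that the server holds after the two
qubits came back; its private ancilla is `ℂ^κ`. -/
abbrev Sys (κ : Type*) := (Fin 2 × Fin 2) × κ

/-- A collective attack of the server with private ancilla `ℂ^κ`. The message register `cl` is the
two-dimensional space with basis `|+1⟩, |-1⟩`, labelled by the units `1, -1` of `ℤ`. -/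
structure Attack (κ : Type*) [Fintype κ] [DecidableEq κ] where
  /-- The state of the two qubits that arrive at `A` and `B`. -/
  init : Matrix (Fin 2 × Fin 2) (Fin 2 × Fin 2) ℂ
  init_posSemidef : init.PosSemidef
  init_trace : init.trace = 1
  /-- The cleared state of the private ancilla. -/
  zeroC : κ → ℂ
  zeroC_unit : braket zeroC zeroC = 1
  /-- The initial state of the message register. -/
  zeroCl : ℤˣ → ℂ
  zeroCl_unit : braket zeroCl zeroCl = 1
  /-- The unitary that the server applies to the returned qubits, its ancilla and `cl`. -/
  U : Matrix (Sys κ × ℤˣ) (Sys κ × ℤˣ) ℂ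
  U_unitary : U ∈ Matrix.unitaryGroup (Sys κ × ℤˣ) ℂ

namespace Attack

variable {κ : Type*} [Fintype κ] [DecidableEq κ] (𝒜 : Attack κ)

/-- `U(|v⟩ ⊗ |0⟩_C ⊗ |0⟩_cl)`, the joint state once the returned qubits in state `v` have been
attacked. -/
def out (v : Fin 2 × Fin 2 → ℂ) : Sys κ × ℤˣ → ℂ :=
  𝒜.U *ᵥ tens (tens v 𝒜.zeroC) 𝒜.zeroCl

/-- `p_{i,j}`: the probability that `A` and `B` measure `|i,j⟩`. -/
def p (i j : Fin 2) : ℝ := (𝒜.init (i, j) (i, j)).re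

/-- The state of the registers of `A` and `B` and of the server, given that `A` and `B` both
measured and resent, before the message register is measured:
`∑ p_{i,j} |i,j⟩⟨i,j| ⊗ U|i,j⟩⟨i,j|U*`. -/
def rhoABC : Matrix ((Fin 2 × Fin 2) × (Sys κ × ℤˣ)) ((Fin 2 × Fin 2) × (Sys κ × ℤˣ)) ℂ :=
  ∑ i, ∑ j, (𝒜.p i j : ℂ) • (ketbra (ket (i, j)) ⊗ₖ ketbra (𝒜.out (ket (i, j))))

/-- The unnormalized state of `A`, `B` and the server after the message register was projected
onto `|-1⟩`. -/
def projMinus : Matrix ((Fin 2 × Fin 2) × Sys κ) ((Fin 2 × Fin 2) × Sys κ) ℂ :=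
  fun x y => 𝒜.rhoABC (x.1, (x.2, -1)) (y.1, (y.2, -1))

/-- `p_a`: the probability that the server sends `-1`, given that `A` and `B` both measured. -/
def pa : ℝ := 𝒜.projMinus.trace.re

/-- The probability that `A` and `B` measure `|i,j⟩` and the server sends `-1`, given that both
measured. -/
def probMinusAnd (i j : Fin 2) : ℝ := (∑ w, 𝒜.projMinus ((i, j), w) ((i, j), w)).re

/-- The probability that the server sends `-1` in the event that `A` and `B` measure `|i,j⟩`. If
this event has probability zero the value is `0`, so that an equality between two such
probabilities for events of probability zero imposes nothing on the attack. -/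
def probMinusGiven (i j : Fin 2) : ℝ := 𝒜.probMinusAnd i j / 𝒜.p i j

/-- The state of `A`, `B` and the server, conditioned on both users measuring and on the
message `-1`. -/
def rhoABC' : Matrix ((Fin 2 × Fin 2) × Sys κ) ((Fin 2 × Fin 2) × Sys κ) ℂ :=
  ((𝒜.pa : ℂ)⁻¹) • 𝒜.projMinus

/-- The same state with the register of `B` traced out. -/
def rhoAC' : Matrix (Fin 2 × Sys κ) (Fin 2 × Sys κ) ℂ :=
  fun x y => ∑ b, 𝒜.rhoABC' ((x.1, b), x.2) ((y.1, b), y.2)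

/-- `I(A:C)`: the mutual information, in bits, between the raw key bit of `A` and the server,
conditioned on the message `-1`. -/
def infoAC : ℝ := mutualInformation 𝒜.rhoAC'

end Attack

end MediatedSQKD

end

/-! Given the message `-1`, the bit of `A` is classical, so `rhoAC'` is a direct sum of two
subnormalized server states `x` and `y`. Symmetry makes both traces 1/2. Hence `I(A:C) = 1 + Tr x
log₂ x + Tr y log₂ y - Tr (x+y) log₂ (x+y)`, a Holevo quantity.

`traceXLogX_add_le` bounds it by `Tr P + Tr N` for every decomposition `x - y = P - N` into positive
operators. To see this, move along `Y_t = (1-t)x + ty` and follow `F(t) = Tr Y_t log Y_t - Tr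
(x+Y_t) log (x+Y_t)`, whose derivative is `Tr (N-P)(log Y_t - log (x+Y_t))`. The logarithm is
operator monotone: the `N` term is nonpositive, and `x + Y_t ≤ ((2-t)/(1-t)) Y_t` bounds the `P`
term by `log((2-t)/(1-t)) Tr P`, whose integral over [0,1] is `2 log 2 · Tr P`. The code replaces
the integral by a grid and the derivative by `klein`.

A suitable `P - N` comes from `exists_ketbra_sub_ketbra_eq`, applied to the pairs 00, 11 and 01, 10.
With `a`, `b` the two `f` vectors of a pair, the difference of projectors is `|a⟩⟨b| + |b⟩⟨a|`, and
equal norms force `Re⟨a|b⟩ = 0`; each positive part then has trace `√(⟨a|a⟩⟨b|b⟩)`, up to the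
weight. -/

open scoped MatrixOrder

namespace MediatedSQKD

/-! ### Spectral sums and entropy -/

section Spectral

variable {n : Type*} [Fintype n] [DecidableEq n]

/-- The sum of `f` over the (real parts of the) roots of the characteristic polynomial; for a
Hermitian matrix this is `∑ f(λᵢ)`. -/
noncomputable def spectralSum (f : ℝ → ℝ) (A : Matrix n n ℂ) : ℝ :=
  (A.charpoly.roots.map fun z => f z.re).sum

/-- `Tr A log A` for a positive semidefinite matrix, in nats. -/
noncomputable def traceXLogX (A : Matrix n n ℂ) : ℝ := spectralSum (fun x => x * Real.log x) A

-- Working with the characteristic polynomial avoids any choice or ordering of eigenvalues, so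
-- reindexing, block sums and functional calculus reduce to identities of polynomials.
open Polynomial in
lemma spectralSum_of_charpoly {ι : Type*} [Fintype ι] {A : Matrix n n ℂ} {d : ι → ℝ}
    (h : A.charpoly = ∏ i, (X - C (d i : ℂ))) (f : ℝ → ℝ) :
    spectralSum f A = ∑ i, f (d i) := by
  rw [spectralSum, h, Polynomial.roots_prod _ _
    (by simp [Finset.prod_ne_zero_iff, Polynomial.X_sub_C_ne_zero])]
  simp [Multiset.map_map]

lemma spectralSum_eq_sum_eigenvalues {A : Matrix n n ℂ} (hA : A.IsHermitian) (f : ℝ → ℝ) :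
    spectralSum f A = ∑ i, f (hA.eigenvalues i) :=
  spectralSum_of_charpoly hA.charpoly_eq f

lemma spectralSum_cfc {A : Matrix n n ℂ} (hA : A.IsHermitian) (f g : ℝ → ℝ) :
    spectralSum f (cfc g A) = ∑ i, f (g (hA.eigenvalues i)) :=
  spectralSum_of_charpoly (hA.charpoly_cfc_eq g) f

lemma spectralSum_smul {A : Matrix n n ℂ} (hA : A.IsHermitian) (f : ℝ → ℝ) (c : ℝ) :
    spectralSum f (c • A) = ∑ i, f (c * hA.eigenvalues i) := by
  have h : cfc (fun x : ℝ => c * x) A = c • A := cfc_const_mul_id c A hA.isSelfAdjoint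
  rw [← h, spectralSum_cfc hA]

lemma spectralSum_add_smul_one {A : Matrix n n ℂ} (hA : A.IsHermitian) (f : ℝ → ℝ) (c : ℝ) :
    spectralSum f (A + c • 1) = ∑ i, f (hA.eigenvalues i + c) := by
  have h : cfc (fun x : ℝ => x + c) A = A + c • 1 := by
    rw [cfc_add_const c (fun x => x) A (by fun_prop) hA.isSelfAdjoint,
      cfc_id' ℝ A hA.isSelfAdjoint, Algebra.algebraMap_eq_smul_one]
  rw [← h, spectralSum_cfc hA]

lemma vonNeumannEntropy_eq {A : Matrix n n ℂ} (hA : A.IsHermitian) :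
    vonNeumannEntropy A = -(traceXLogX A / Real.log 2) := by
  have : vonNeumannEntropy A = -∑ i, hA.eigenvalues i * Real.logb 2 (hA.eigenvalues i) := by
    unfold vonNeumannEntropy
    rw [dif_pos hA]
  rw [this, traceXLogX, spectralSum_eq_sum_eigenvalues hA, Finset.sum_div]
  simp only [Real.logb, mul_div_assoc]

lemma re_trace_eq_sum_eigenvalues {A : Matrix n n ℂ} (hA : A.IsHermitian) :
    A.trace.re = ∑ i, hA.eigenvalues i := by
  rw [hA.trace_eq_sum_eigenvalues]
  simp

lemma traceXLogX_smul {A : Matrix n n ℂ} (hA : A.IsHermitian) {c : ℝ} (hc : 0 < c) :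
    traceXLogX (c • A) = c * traceXLogX A + c * Real.log c * A.trace.re := by
  rw [traceXLogX, traceXLogX, spectralSum_smul hA, spectralSum_eq_sum_eigenvalues hA,
    re_trace_eq_sum_eigenvalues hA, Finset.mul_sum, Finset.mul_sum, ← Finset.sum_add_distrib]
  refine Finset.sum_congr rfl fun i _ => ?_
  by_cases h : hA.eigenvalues i = 0
  · simp [h]
  · rw [Real.log_mul hc.ne' h]
    ring

lemma charpoly_blockDiagonal {o : Type*} [Fintype o] [DecidableEq o] (M : o → Matrix n n ℂ) :
    (Matrix.blockDiagonal M).charpoly = ∏ k, (M k).charpoly := by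
  have : (Matrix.blockDiagonal M).charmatrix = Matrix.blockDiagonal fun k => (M k).charmatrix := by
    ext ⟨i, k⟩ ⟨j, l⟩
    by_cases hkl : k = l
    · subst hkl
      by_cases hij : i = j
      · subst hij; simp [Matrix.blockDiagonal_apply]
      · simp [Matrix.blockDiagonal_apply, hij]
    · simp [Matrix.blockDiagonal_apply, hkl]
  rw [Matrix.charpoly, this, Matrix.det_blockDiagonal]
  rfl

lemma spectralSum_blockDiagonal {o : Type*} [Fintype o] [DecidableEq o] (f : ℝ → ℝ)
    (M : o → Matrix n n ℂ) :
    spectralSum f (Matrix.blockDiagonal M) = ∑ k, spectralSum f (M k) := by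
  simp only [spectralSum]
  rw [charpoly_blockDiagonal, Polynomial.roots_prod _ _
    (Finset.prod_ne_zero_iff.2 fun k _ => (Matrix.charpoly_monic (M k)).ne_zero), Multiset.map_bind,
    Multiset.sum_bind]
  rfl

/-! ### Trace inequalities and operator monotonicity of the logarithm -/

/-- `Re Tr f(A)g(B)` in terms of the eigenvalues and the overlaps of the eigenbases. -/
lemma exists_overlaps {A B : Matrix n n ℂ} (hA : A.IsHermitian) (hB : B.IsHermitian) :
    ∃ w : n → n → ℝ, (∀ i j, 0 ≤ w i j) ∧ ∀ f g : ℝ → ℝ,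
      (cfc f A * cfc g B).trace.re =
        ∑ i, ∑ j, f (hA.eigenvalues i) * g (hB.eigenvalues j) * w i j := by
  -- `V` is the change of basis between the two eigenbases; the weights are `|⟨a_i|b_j⟩|²`.
  set V : Matrix n n ℂ := star (hA.eigenvectorUnitary : Matrix n n ℂ) * hB.eigenvectorUnitary
    with hV
  refine ⟨fun i j => Complex.normSq (V i j), fun i j => Complex.normSq_nonneg _, fun f g => ?_⟩
  rw [hA.cfc_eq, hB.cfc_eq, Matrix.IsHermitian.cfc, Matrix.IsHermitian.cfc,
    Unitary.conjStarAlgAut_apply, Unitary.conjStarAlgAut_apply]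
  set D := Matrix.diagonal (RCLike.ofReal (K := ℂ) ∘ f ∘ hA.eigenvalues)
  set E := Matrix.diagonal (RCLike.ofReal (K := ℂ) ∘ g ∘ hB.eigenvalues)
  have : ((hA.eigenvectorUnitary : Matrix n n ℂ) * D * star (hA.eigenvectorUnitary : Matrix n n ℂ) *
      ((hB.eigenvectorUnitary : Matrix n n ℂ) * E *
        star (hB.eigenvectorUnitary : Matrix n n ℂ))).trace = (D * (V * (E * star V))).trace := by
    rw [hV, star_mul, star_star, mul_assoc, mul_assoc, Matrix.trace_mul_comm]
    simp only [mul_assoc]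
  rw [this, Matrix.trace, Complex.re_sum]
  refine Finset.sum_congr rfl fun i _ => ?_
  rw [Matrix.diag_apply, Matrix.diagonal_mul, Matrix.mul_apply, Finset.mul_sum, Complex.re_sum]
  refine Finset.sum_congr rfl fun j _ => ?_
  rw [Matrix.diagonal_mul, Matrix.star_apply]
  have : ((RCLike.ofReal (K := ℂ) ∘ f ∘ hA.eigenvalues) i) *
      (V i j * ((RCLike.ofReal (K := ℂ) ∘ g ∘ hB.eigenvalues) j * star (V i j))) =
      ((f (hA.eigenvalues i) * g (hB.eigenvalues j) * Complex.normSq (V i j) : ℝ) : ℂ) := by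
    push_cast
    rw [Complex.normSq_eq_conj_mul_self]
    simp
    ring
  rw [this, Complex.ofReal_re]

/-- The spectrum is finite, so even `Real.log` at 0 is admissible in the functional calculus. -/
lemma continuousOn_spectrum (f : ℝ → ℝ) (A : Matrix n n ℂ) : ContinuousOn f (spectrum ℝ A) :=
  A.finite_real_spectrum.continuousOn f

lemma re_trace_mul_log {A : Matrix n n ℂ} (hA : A.IsHermitian) :
    (A * cfc Real.log A).trace.re = traceXLogX A := by
  have h : A * cfc Real.log A = cfc (fun x : ℝ => x * Real.log x) A := by
    rw [cfc_mul (fun x => x) Real.log A (continuousOn_spectrum _ _) (continuousOn_spectrum _ _),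
      cfc_id' ℝ A hA.isSelfAdjoint]
  have h2 : (cfc (fun x : ℝ => x * Real.log x) A).IsHermitian :=
    cfc_predicate (fun x : ℝ => x * Real.log x) A
  rw [h, re_trace_eq_sum_eigenvalues h2, traceXLogX, spectralSum_eq_sum_eigenvalues hA,
    ← spectralSum_cfc hA (fun x => x) (fun x => x * Real.log x), spectralSum_eq_sum_eigenvalues h2]

/-- **Klein's inequality**, as the subgradient inequality for `A ↦ Tr A log A`. -/
lemma klein {A B : Matrix n n ℂ} (hA : A.PosSemidef) (hB : B.PosDef) :
    ((A - B) * cfc Real.log B).trace.re + (A - B).trace.re ≤ traceXLogX A - traceXLogX B := by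
  obtain ⟨w, hw, h⟩ := exists_overlaps hA.1 hB.1
  have e1 := h (fun x => x) Real.log
  have e2 := h (fun x => x * Real.log x) (fun _ => 1)
  have e3 := h (fun x => x) (fun _ => 1)
  have e4 := h (fun _ => 1) (fun x => x)
  rw [cfc_id' ℝ A hA.1.isSelfAdjoint] at e1 e3
  rw [cfc_id' ℝ B hB.1.isSelfAdjoint, cfc_const_one ℝ A hA.1.isSelfAdjoint, one_mul] at e4
  rw [cfc_const_one ℝ B hB.1.isSelfAdjoint, mul_one] at e2 e3
  rw [cfc_mul (fun x => x) Real.log A (continuousOn_spectrum _ _) (continuousOn_spectrum _ _),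
      cfc_id' ℝ A hA.1.isSelfAdjoint, re_trace_mul_log hA.1] at e2
  rw [sub_mul, Matrix.trace_sub, Complex.sub_re, re_trace_mul_log hB.1, Matrix.trace_sub,
    Complex.sub_re, e1, e2, e3, e4]
  -- The overlaps reduce the claim to the scalar inequality `a log a - a log b - a + b ≥ 0`, which
  -- is `log (b/a) ≤ b/a - 1`; at `a = 0` it reads `b ≥ 0`.
  have : 0 ≤ ∑ i, ∑ j, (hA.1.eigenvalues i * Real.log (hA.1.eigenvalues i)
      - hA.1.eigenvalues i * Real.log (hB.1.eigenvalues j)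
      - hA.1.eigenvalues i + hB.1.eigenvalues j) * w i j := by
    refine Finset.sum_nonneg fun i _ => Finset.sum_nonneg fun j _ => mul_nonneg ?_ (hw i j)
    have ha := hA.eigenvalues_nonneg i
    have hb := hB.eigenvalues_pos j
    rcases ha.eq_or_lt with h0 | ha
    · rw [← h0]; simpa using hb.le
    · have h1 := Real.log_le_sub_one_of_pos (div_pos hb ha)
      rw [Real.log_div hb.ne' ha.ne'] at h1
      have h2 := mul_le_mul_of_nonneg_left h1 ha.le
      have h3 : hA.1.eigenvalues i * (hB.1.eigenvalues j / hA.1.eigenvalues i - 1) =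
        hB.1.eigenvalues j - hA.1.eigenvalues i := by field_simp
      rw [h3] at h2
      linarith
  simp only [sub_mul, add_mul, Finset.sum_sub_distrib, Finset.sum_add_distrib, mul_one, one_mul]
    at this ⊢
  linarith

lemma re_trace_mul_nonneg {A B : Matrix n n ℂ} (hA : A.PosSemidef) (hB : B.PosSemidef) :
    0 ≤ (A * B).trace.re := by
  obtain ⟨w, hw, h⟩ := exists_overlaps hA.1 hB.1
  have e := h (fun x => x) (fun x => x)
  rw [cfc_id' ℝ A hA.1.isSelfAdjoint, cfc_id' ℝ B hB.1.isSelfAdjoint] at e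
  rw [e]
  exact Finset.sum_nonneg fun i _ => Finset.sum_nonneg fun j _ =>
    mul_nonneg (mul_nonneg (hA.eigenvalues_nonneg i) (hB.eigenvalues_nonneg j)) (hw i j)

lemma cfc_log_le_cfc_log {A B : Matrix n n ℂ} (hA : A.PosDef) (h : A ≤ B) :
    cfc Real.log A ≤ cfc Real.log B := by
  open scoped Matrix.Norms.L2Operator in
  exact CFC.log_le_log h (Matrix.isStrictlyPositive_iff_posDef.2 hA)

lemma cfc_log_smul {B : Matrix n n ℂ} (hB : B.PosDef) {c : ℝ} (hc : 0 < c) :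
    cfc Real.log (c • B) = algebraMap ℝ (Matrix n n ℂ) (Real.log c) + cfc Real.log B := by
  open scoped Matrix.Norms.L2Operator in
  refine CFC.log_smul B (fun x hx => ?_) hc.ne' hB.1
  rw [hB.1.spectrum_real_eq_range_eigenvalues] at hx
  obtain ⟨i, rfl⟩ := hx
  exact (hB.eigenvalues_pos i).ne'

/-- Operator monotonicity of the logarithm, tested against a positive semidefinite matrix. -/
lemma re_trace_mul_log_sub_log_le {A B N : Matrix n n ℂ} (hA : A.PosDef) (hB : B.PosDef)
    (hN : N.PosSemidef) {c : ℝ} (hc : 0 < c) (h : (c • B - A).PosSemidef) :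
    (N * (cfc Real.log A - cfc Real.log B)).trace.re ≤ Real.log c * N.trace.re := by
  have h1 := cfc_log_le_cfc_log hA (Matrix.le_iff.2 h)
  have h2 := cfc_log_smul hB hc
  rw [h2] at h1
  have h3 := re_trace_mul_nonneg hN (Matrix.le_iff.1 h1)
  have h4 : N * (algebraMap ℝ (Matrix n n ℂ) (Real.log c) + cfc Real.log B - cfc Real.log A) =
      Real.log c • N - N * (cfc Real.log A - cfc Real.log B) := by
    rw [Algebra.algebraMap_eq_smul_one, add_sub_assoc, mul_add, mul_smul_comm, mul_one, mul_sub,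
      mul_sub]
    abel
  rw [h4, Matrix.trace_sub, Matrix.trace_smul, Complex.sub_re, Complex.smul_re, smul_eq_mul] at h3
  linarith

/-- A positive definite matrix dominates every Hermitian matrix up to a constant. -/
lemma exists_smul_sub_posSemidef {A B : Matrix n n ℂ} (hA : A.PosDef) (hB : B.PosSemidef) :
    ∃ c : ℝ, 1 ≤ c ∧ (c • A - B).PosSemidef := by
  obtain ⟨m, hm, hmA⟩ : ∃ m : ℝ, 0 < m ∧ ∀ i, m ≤ hA.1.eigenvalues i := by
    rcases isEmpty_or_nonempty n with _ | _
    · exact ⟨1, one_pos, fun i => isEmptyElim i⟩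
    · obtain ⟨i, hi⟩ := Finite.exists_min hA.1.eigenvalues
      exact ⟨_, hA.eigenvalues_pos i, hi⟩
  have h1 : (A - m • 1).PosSemidef := by
    have h : cfc (fun x : ℝ => x - m) A = A - m • 1 := by
      rw [cfc_sub (fun x : ℝ => x) (fun _ => m) A (continuousOn_spectrum _ _)
        (continuousOn_spectrum _ _), cfc_id' ℝ A hA.1.isSelfAdjoint,
        cfc_const m A hA.1.isSelfAdjoint,
        Algebra.algebraMap_eq_smul_one]
    rw [← h, ← Matrix.nonneg_iff_posSemidef]
    refine cfc_nonneg fun x hx => ?_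
    rw [hA.1.spectrum_real_eq_range_eigenvalues] at hx
    obtain ⟨i, rfl⟩ := hx
    exact sub_nonneg.2 (hmA i)
  have h2 : (B.trace.re • 1 - B).PosSemidef := by
    have h : cfc (fun x : ℝ => B.trace.re - x) B = B.trace.re • 1 - B := by
      rw [cfc_sub (fun _ => B.trace.re) (fun x : ℝ => x) B (continuousOn_spectrum _ _)
        (continuousOn_spectrum _ _), cfc_id' ℝ B hB.1.isSelfAdjoint,
        cfc_const _ B hB.1.isSelfAdjoint,
        Algebra.algebraMap_eq_smul_one]
    rw [← h, ← Matrix.nonneg_iff_posSemidef]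
    refine cfc_nonneg fun x hx => ?_
    rw [hB.1.spectrum_real_eq_range_eigenvalues] at hx
    obtain ⟨i, rfl⟩ := hx
    rw [re_trace_eq_sum_eigenvalues hB.1, sub_nonneg]
    exact Finset.single_le_sum (fun j _ => hB.eigenvalues_nonneg j) (Finset.mem_univ i)
  -- Since `A ≥ m·1` and `B ≤ (Tr B)·1`, any `c ≥ Tr B / m` works.
  set c : ℝ := max 1 (B.trace.re / m) with hc
  have hc1 : 1 ≤ c := le_max_left _ _
  have hc2 : 0 ≤ c * m - B.trace.re := by
    rw [sub_nonneg, ← div_le_iff₀ hm]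
    exact le_max_right _ _
  refine ⟨c, hc1, ?_⟩
  have : c • A - B =
      c • (A - m • 1) + (c * m - B.trace.re) • (1 : Matrix n n ℂ) + (B.trace.re • 1 - B) := by
    rw [smul_sub, smul_smul, sub_smul]
    abel
  rw [this]
  exact ((h1.smul (zero_le_one.trans hc1)).add (Matrix.PosSemidef.one.smul hc2)).add h2

end Spectral

/-! ### The Holevo quantity is at most the trace distance -/

section HolevoTrace

variable {n : Type*} [Fintype n] [DecidableEq n]

/-- One grid step, standing in for the integral of the derivative of `F` over `[s, t]`. The
constants `c` and `d` absorb the mismatch of comparing `Y_t` with `x + Y_s` at different times. -/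
lemma traceXLogX_segment_step {x y P N : Matrix n n ℂ} (hx : x.PosDef) (hy : y.PosDef)
    (hP : P.PosSemidef) (hN : N.PosSemidef) (hxy : x - y = P - N) {s t c d : ℝ}
    (hs : 0 ≤ s) (hst : s ≤ t) (ht : t ≤ 1) (hc : 0 < c) (hd : 0 < d)
    (h1 : (c • (x + AffineMap.lineMap x y s) - AffineMap.lineMap x y t).PosSemidef)
    (h2 : (d • AffineMap.lineMap x y t - (x + AffineMap.lineMap x y s)).PosSemidef) :
    (traceXLogX (AffineMap.lineMap x y t) - traceXLogX (x + AffineMap.lineMap x y t)) -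
      (traceXLogX (AffineMap.lineMap x y s) - traceXLogX (x + AffineMap.lineMap x y s)) ≤
      (t - s) * (Real.log c * N.trace.re + Real.log d * P.trace.re) := by
  have hY : ∀ r : ℝ, 0 ≤ r → r ≤ 1 → (AffineMap.lineMap x y r : Matrix n n ℂ).PosDef := by
    intro r h0 h1
    rw [AffineMap.lineMap_apply_module]
    rcases h0.eq_or_lt with rfl | h0
    · simpa using hx
    · exact (hy.smul h0).posSemidef_add (hx.posSemidef.smul (sub_nonneg.2 h1))
  have hYs := hY s hs (hst.trans ht)
  have hYt := hY t (hs.trans hst) ht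
  have hD : (AffineMap.lineMap x y t - AffineMap.lineMap x y s : Matrix n n ℂ) =
      (t - s) • (N - P) := by
    rw [← neg_sub P N, ← hxy, AffineMap.lineMap_apply_module, AffineMap.lineMap_apply_module]
    module
  -- The tangent of the first term is taken at `t` and that of the second at `s`, so that both
  -- errors have the favourable sign; the linear trace terms cancel.
  have k1 := klein hYs.posSemidef hYt
  have k2 := klein (hx.add hYt).posSemidef (hx.add hYs)
  rw [add_sub_add_left_eq_sub, hD] at k2
  rw [← neg_sub, hD] at k1
  have b1 := re_trace_mul_log_sub_log_le hYt (hx.add hYs) hN hc h1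
  have b2 := re_trace_mul_log_sub_log_le (hx.add hYs) hYt hP hd h2
  have b3 := mul_le_mul_of_nonneg_left (add_le_add b1 b2) (sub_nonneg.2 hst)
  simp only [neg_mul, smul_mul_assoc, sub_mul, mul_sub, Matrix.trace_neg, Matrix.trace_smul,
    Matrix.trace_sub, Complex.neg_re, Complex.smul_re, Complex.sub_re, smul_eq_mul] at k1 k2 b3
  linarith

lemma sum_range_log_succ_div (C : ℝ) (m : ℕ) :
    ∑ k ∈ Finset.range (m + 1), Real.log (if k = 0 then C else ((k : ℝ) + 1) / k) =
      Real.log C + Real.log (m + 1) := by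
  induction m with
  | zero => simp
  | succ m ih =>
    rw [Finset.sum_range_succ, ih, if_neg (by omega), Real.log_div (by positivity) (by positivity)]
    push_cast
    ring

/-- A discrete form of `∫₀¹ log((2-t)/(1-t)) dt = 2 log 2`: the product of the ratios is a binomial
coefficient of `2(m+1)`, hence at most `2^(2(m+1))`. -/
lemma sum_range_log_div_le (m : ℕ) :
    ∑ k ∈ Finset.range m, Real.log ((2 * (m + 1) - k : ℝ) / (m - k)) ≤
      2 * (m + 1) * Real.log 2 := by
  have hk : ∀ k ∈ Finset.range m, (0 : ℝ) < m - k := fun k hk => by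
    rw [sub_pos]
    exact_mod_cast Finset.mem_range.1 hk
  rw [← Real.log_prod fun k h => by
    have := hk k h
    exact (div_pos (by linarith) this).ne']
  have e : ∏ k ∈ Finset.range m, ((2 * (m + 1) - k : ℝ) / (m - k)) =
      ((2 * (m + 1)).choose m : ℝ) := by
    rw [Finset.prod_div_distrib, Nat.choose_eq_descFactorial_div_factorial,
      Nat.cast_div (Nat.factorial_dvd_descFactorial _ _) (by positivity), ← Nat.descFactorial_self m,
      Nat.descFactorial_eq_prod_range, Nat.descFactorial_eq_prod_range]
    push_cast
    congr 1
    · refine Finset.prod_congr rfl fun k h => ?_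
      rw [Nat.cast_sub (by have := Finset.mem_range.1 h; omega)]
      push_cast
      ring
    · refine Finset.prod_congr rfl fun k h => ?_
      rw [Nat.cast_sub (Finset.mem_range.1 h).le]
  rw [e]
  have h2 : (2 * (m + 1) : ℝ) * Real.log 2 = Real.log (2 ^ (2 * (m + 1))) := by
    rw [Real.log_pow]
    push_cast
    ring
  rw [h2]
  refine Real.log_le_log ?_ ?_
  · exact_mod_cast Nat.choose_pos (by omega)
  · exact_mod_cast Nat.choose_le_two_pow _ _

lemma traceXLogX_add_le_of_posDef {x y P N : Matrix n n ℂ} (hx : x.PosDef) (hy : y.PosDef)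
    (hP : P.PosSemidef) (hN : N.PosSemidef) (hxy : x - y = P - N) :
    traceXLogX x + traceXLogX y - traceXLogX (x + y) + Real.log 2 * (x.trace.re + y.trace.re) ≤
      Real.log 2 * (P.trace.re + N.trace.re) := by
  obtain ⟨C, hC1, hC⟩ := exists_smul_sub_posSemidef hx hy.posSemidef
  obtain ⟨D, hD1, hD⟩ := exists_smul_sub_posSemidef hy hx.posSemidef
  set F : ℝ → ℝ := fun t =>
    traceXLogX (AffineMap.lineMap x y t) - traceXLogX (x + AffineMap.lineMap x y t) with hF
  have key : ∀ m : ℕ, F 1 - F 0 ≤ (Real.log C + Real.log (m + 1)) / (m + 1) * N.trace.re +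
      (Real.log (2 * D + 1) / (m + 1) + 2 * Real.log 2) * P.trace.re := by
    intro m
    have hm : (0 : ℝ) < m + 1 := by positivity
    -- With `s = k/(m+1)` and `t = (k+1)/(m+1)`, `c` is `t/s`, matching the coefficients of `y`, and
    -- `d` is `(2-s)/(1-t)`, matching those of `x`. These degenerate at `s = 0` and `t = 1`, where
    -- `y ≤ C x` and `x ≤ D y` are used; the two end terms vanish after division by `m+1`.
    set c : ℕ → ℝ := fun k => if k = 0 then C else ((k : ℝ) + 1) / k with hc
    set d : ℕ → ℝ := fun k => if k = m then 2 * D + 1 else (2 * (m + 1) - k : ℝ) / (m - k) with hd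
    have step : ∀ k ∈ Finset.range (m + 1), F ((k + 1 : ℕ) / (m + 1)) - F (k / (m + 1)) ≤
        1 / (m + 1) * (Real.log (c k) * N.trace.re + Real.log (d k) * P.trace.re) := by
      intro k hk
      have hkm : k ≤ m := Nat.lt_succ_iff.1 (Finset.mem_range.1 hk)
      have hkm' : (k : ℝ) ≤ m := by exact_mod_cast hkm
      have e : (1 : ℝ) / (m + 1) = (k + 1 : ℕ) / (m + 1) - k / (m + 1) := by
        push_cast
        ring
      rw [e]
      have comb : ∀ a b : ℝ, 0 ≤ a → 0 ≤ b → (a • x + b • y).PosSemidef := fun a b ha hb =>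
        (hx.posSemidef.smul ha).add (hy.posSemidef.smul hb)
      refine traceXLogX_segment_step hx hy hP hN hxy (by positivity) ?_ ?_ ?_ ?_ ?_ ?_
      · push_cast
        gcongr
        linarith
      · rw [div_le_one hm]
        push_cast
        linarith
      · rcases Nat.eq_zero_or_pos k with rfl | h
        · simp only [hc, if_true]
          linarith
        · simp only [hc, h.ne', if_false]
          positivity
      · by_cases h : k = m
        · simp only [hd, h, if_true]
          linarith
        · have : (k : ℝ) < m := by exact_mod_cast lt_of_le_of_ne hkm h
          simp only [hd, h, if_false]
          exact div_pos (by linarith) (by linarith)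
      · rw [AffineMap.lineMap_apply_module, AffineMap.lineMap_apply_module]
        rcases Nat.eq_zero_or_pos k with rfl | h
        · simp only [hc, if_true]
          have hpos : (0 : ℝ) ≤ 1 / (m + 1) := by positivity
          have hle : (1 : ℝ) / (m + 1) ≤ 1 := (div_le_one hm).2 (by linarith)
          have := (hC.smul hpos).add
            (comb ((2 - 1 / (m + 1)) * C - (1 - 1 / (m + 1))) 0 (by nlinarith) le_rfl)
          convert this using 1
          push_cast
          simp only [zero_div]
          module
        · simp only [hc, h.ne', if_false]
          have hk0 : (0 : ℝ) < k := by exact_mod_cast h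
          have h1 : 0 ≤ ((k : ℝ) + 1) / k * (2 - k / (m + 1)) - (1 - (k + 1) / (m + 1)) := by
            have a1 : (k : ℝ) / (m + 1) ≤ 1 := (div_le_one hm).2 (by linarith)
            have a2 : 0 ≤ ((k : ℝ) + 1) / (m + 1) := by positivity
            have a3 : 1 ≤ ((k : ℝ) + 1) / k := (one_le_div hk0).2 (by linarith)
            nlinarith
          have := comb _ 0 h1 le_rfl
          convert this using 1
          have h2 : ((k : ℝ) + 1) / (m + 1) = ((k : ℝ) + 1) / k * (k / (m + 1)) := by
            field_simp
          push_cast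
          rw [h2]
          module
      · rw [AffineMap.lineMap_apply_module, AffineMap.lineMap_apply_module]
        by_cases h : k = m
        · simp only [hd, h, if_true]
          have h1 : ((m + 1 : ℕ) : ℝ) / (m + 1) = 1 := by
            push_cast
            exact div_self hm.ne'
          have h2 : (0 : ℝ) ≤ m / (m + 1) := by positivity
          have h3 : (m : ℝ) / (m + 1) ≤ 1 := (div_le_one hm).2 (by linarith)
          rw [h1]
          have := (hD.smul (sub_nonneg.2 (h3.trans one_le_two))).add
            (comb 0 ((2 * D + 1) - m / (m + 1) - (2 - m / (m + 1)) * D) le_rfl (by nlinarith))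
          convert this using 1
          module
        · have hlt : (0 : ℝ) < m - k := by
            rw [sub_pos]
            exact_mod_cast lt_of_le_of_ne hkm h
          simp only [hd, h, if_false]
          have h1 : 0 ≤ (2 * (m + 1) - k : ℝ) / (m - k) * ((k + 1) / (m + 1)) - k / (m + 1) := by
            have a1 : 1 ≤ (2 * (m + 1) - k : ℝ) / (m - k) := (one_le_div hlt).2 (by linarith)
            have a2 : (k : ℝ) / (m + 1) ≤ (k + 1) / (m + 1) := by gcongr; linarith
            have a3 : 0 ≤ (k : ℝ) / (m + 1) := by positivity
            nlinarith
          have := comb 0 _ le_rfl h1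
          convert this using 1
          have h2 : (2 : ℝ) - k / (m + 1) =
              (2 * (m + 1) - k : ℝ) / (m - k) * (1 - (k + 1) / (m + 1)) := by
            field_simp
            ring
          have h3 : x + ((1 - (k : ℝ) / (m + 1)) • x + ((k : ℝ) / (m + 1)) • y) =
              (2 - (k : ℝ) / (m + 1)) • x + ((k : ℝ) / (m + 1)) • y := by module
          rw [h3, h2]
          push_cast
          module
    have tele := Finset.sum_le_sum step
    rw [Finset.sum_range_sub (fun k : ℕ => F (k / (m + 1))), ← Finset.mul_sum,
      Finset.sum_add_distrib, ← Finset.sum_mul, ← Finset.sum_mul, sum_range_log_succ_div] at tele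
    have e1 : ((m + 1 : ℕ) : ℝ) / (m + 1) = 1 := by
      push_cast
      exact div_self hm.ne'
    have hsum : ∑ k ∈ Finset.range (m + 1), Real.log (d k) ≤
        2 * (m + 1) * Real.log 2 + Real.log (2 * D + 1) := by
      rw [Finset.sum_range_succ]
      refine add_le_add (le_trans (le_of_eq ?_) (sum_range_log_div_le m)) (by simp [hd])
      refine Finset.sum_congr rfl fun k hk => ?_
      simp only [hd, (Finset.mem_range.1 hk).ne, if_false]
    have hPt : 0 ≤ P.trace.re := (Complex.le_def.1 hP.trace_nonneg).1
    rw [e1, Nat.cast_zero, zero_div] at tele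
    refine tele.trans ?_
    have := mul_le_mul_of_nonneg_right hsum hPt
    rw [one_div, inv_mul_le_iff₀ hm]
    refine (add_le_add_right this _).trans (le_of_eq ?_)
    field_simp
    ring
  have lim : F 1 - F 0 ≤ 2 * Real.log 2 * P.trace.re := by
    have t0 : Filter.Tendsto (fun m : ℕ => ((m : ℝ) + 1)) Filter.atTop Filter.atTop :=
      Filter.tendsto_atTop_add_const_right _ _ tendsto_natCast_atTop_atTop
    have t1 : Filter.Tendsto (fun m : ℕ => Real.log ((m : ℝ) + 1) / (m + 1)) Filter.atTop
        (nhds 0) := by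
      have := (Real.tendsto_pow_log_div_mul_add_atTop 1 0 1 one_ne_zero).comp t0
      simpa [Function.comp_def] using this
    have t2 : ∀ r : ℝ, Filter.Tendsto (fun m : ℕ => r / ((m : ℝ) + 1)) Filter.atTop (nhds 0) :=
      fun r => t0.const_div_atTop r
    have := (((t2 (Real.log C)).add t1).mul_const N.trace.re).add
      (((t2 (Real.log (2 * D + 1))).add_const (2 * Real.log 2)).mul_const P.trace.re)
    refine ge_of_tendsto' (by simpa using this) fun m => (key m).trans (le_of_eq ?_)
    ring
  have hF1 : F 1 = traceXLogX y - traceXLogX (x + y) := by simp [hF]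
  have hF0 : F 0 = -traceXLogX x - 2 * Real.log 2 * x.trace.re := by
    simp only [hF, AffineMap.lineMap_apply_zero]
    rw [← two_smul ℝ x, traceXLogX_smul hx.1 two_pos]
    ring
  -- The bound so far involves only `Tr x` and `Tr P`; `Tr x - Tr y = Tr P - Tr N` makes it
  -- symmetric.
  have htr := congrArg (fun M : Matrix n n ℂ => M.trace.re) hxy
  simp only [Matrix.trace_sub, Complex.sub_re] at htr
  have h3 : Real.log 2 * (x.trace.re - y.trace.re) = Real.log 2 * (P.trace.re - N.trace.re) := by
    rw [htr]
  rw [hF1, hF0] at lim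
  linarith

lemma tendsto_traceXLogX_add_smul_one {A : Matrix n n ℂ} (hA : A.IsHermitian) (c : ℝ) :
    Filter.Tendsto (fun ε : ℝ => traceXLogX (A + (c * ε) • 1)) (nhdsWithin 0 (Set.Ioi 0))
      (nhds (traceXLogX A)) := by
  refine Filter.Tendsto.mono_left ?_ nhdsWithin_le_nhds
  simp only [traceXLogX, spectralSum_add_smul_one hA, spectralSum_eq_sum_eigenvalues hA]
  refine tendsto_finsetSum _ fun i _ => ?_
  have : Continuous fun ε : ℝ =>
      (hA.eigenvalues i + c * ε) * Real.log (hA.eigenvalues i + c * ε) :=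
    Real.continuous_mul_log.comp (by fun_prop)
  simpa using this.tendsto 0

/-- The Holevo quantity of two positive operators is bounded, in bits, by the trace distance:
any decomposition `x - y = P - N` gives an upper bound. -/
theorem traceXLogX_add_le {x y P N : Matrix n n ℂ} (hx : x.PosSemidef) (hy : y.PosSemidef)
    (hP : P.PosSemidef) (hN : N.PosSemidef) (hxy : x - y = P - N) :
    traceXLogX x + traceXLogX y - traceXLogX (x + y) + Real.log 2 * (x.trace.re + y.trace.re) ≤
      Real.log 2 * (P.trace.re + N.trace.re) := by
  have t1 := tendsto_traceXLogX_add_smul_one hx.1 1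
  have t2 := tendsto_traceXLogX_add_smul_one hy.1 1
  have t3 := tendsto_traceXLogX_add_smul_one (hx.1.add hy.1) 2
  have t4 : Filter.Tendsto
      (fun ε : ℝ => Real.log 2 * ((x + (1 * ε) • 1).trace.re + (y + (1 * ε) • 1).trace.re))
      (nhdsWithin 0 (Set.Ioi 0)) (nhds (Real.log 2 * (x.trace.re + y.trace.re))) := by
    refine Filter.Tendsto.mono_left ?_ nhdsWithin_le_nhds
    simp only [Matrix.trace_add, Matrix.trace_smul, Complex.add_re, Complex.smul_re]
    have : Continuous fun ε : ℝ => Real.log 2 *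
        (x.trace.re + (1 * ε) • (1 : Matrix n n ℂ).trace.re +
          (y.trace.re + (1 * ε) • (1 : Matrix n n ℂ).trace.re)) := by fun_prop
    simpa using this.tendsto 0
  refine le_of_tendsto (((t1.add t2).sub t3).add t4) ?_
  filter_upwards [self_mem_nhdsWithin] with ε hε
  have hε' : (((1 * ε) • 1 : Matrix n n ℂ)).PosDef := by
    rw [one_mul]
    exact Matrix.PosDef.one.smul hε
  -- Shifting both operators by `ε·1` leaves `x - y` unchanged, so the same `P` and `N` serve; their
  -- sum shifts by `2ε·1`.
  have := traceXLogX_add_le_of_posDef (hε'.posSemidef_add hx) (hε'.posSemidef_add hy) hP hN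
    (by rw [add_sub_add_right_eq_sub, hxy])
  have e : x + (1 * ε) • 1 + (y + (1 * ε) • 1) = x + y + (2 * ε) • 1 := by module
  rwa [e] at this

end HolevoTrace

/-! ### Differences of rank-one projectors -/

section Vectors

variable {m n : Type*} [Fintype m] [Fintype n]

lemma braket_self_re (v : n → ℂ) : (braket v v).re = ∑ i, Complex.normSq (v i) := by
  simp [braket, dotProduct, Complex.normSq_apply]

lemma braket_self_re_nonneg (v : n → ℂ) : 0 ≤ (braket v v).re := by
  rw [braket_self_re]
  exact Finset.sum_nonneg fun i _ => Complex.normSq_nonneg _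

lemma eq_zero_of_braket_self_re_eq_zero {v : n → ℂ} (h : (braket v v).re = 0) : v = 0 := by
  rw [braket_self_re, Finset.sum_eq_zero_iff_of_nonneg fun i _ => Complex.normSq_nonneg _] at h
  ext i
  exact Complex.normSq_eq_zero.1 (h i (Finset.mem_univ i))

lemma braket_tens (v v' : m → ℂ) (w w' : n → ℂ) :
    braket (tens v w) (tens v' w') = braket v v' * braket w w' := by
  simp only [braket, tens, dotProduct, Fintype.sum_prod_type, Finset.sum_mul_sum, Pi.star_apply,
    star_mul']
  exact Finset.sum_congr rfl fun i _ => Finset.sum_congr rfl fun j _ => by ring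

lemma braket_mulVec_of_unitary [DecidableEq n] {U : Matrix n n ℂ}
    (hU : U ∈ Matrix.unitaryGroup n ℂ) (v : n → ℂ) : braket (U *ᵥ v) (U *ᵥ v) = braket v v := by
  rw [braket, Matrix.star_mulVec, Matrix.dotProduct_mulVec, Matrix.vecMul_vecMul,
    ← Matrix.star_eq_conjTranspose, Matrix.mem_unitaryGroup_iff'.1 hU, Matrix.vecMul_one, braket]

lemma trace_ketbra_re (v : n → ℂ) : (ketbra v).trace.re = (braket v v).re := by
  rw [ketbra, Matrix.trace_vecMulVec, dotProduct_comm, braket]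

lemma posSemidef_ketbra (v : n → ℂ) : (ketbra v).PosSemidef :=
  Matrix.posSemidef_vecMulVec_self_star v

lemma braket_add_self_re {a b : n → ℂ} (h : (braket a b).re = 0) (s t : ℝ) :
    (braket (s • a + t • b) (s • a + t • b)).re =
      s ^ 2 * (braket a a).re + t ^ 2 * (braket b b).re := by
  have hb : (braket a b).re = ∑ i, ((a i).re * (b i).re + (a i).im * (b i).im) := by
    simp [braket, dotProduct]
  rw [hb] at h
  have h2 : (braket (s • a + t • b) (s • a + t • b)).re = s ^ 2 * (braket a a).re +
      t ^ 2 * (braket b b).re + 2 * s * t * ∑ i, ((a i).re * (b i).re + (a i).im * (b i).im) := by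
    simp only [braket_self_re, Finset.mul_sum, ← Finset.sum_add_distrib]
    refine Finset.sum_congr rfl fun i _ => ?_
    simp [Complex.normSq_apply]
    ring
  rw [h2, h]
  ring

/-- The difference of the projectors onto two vectors of equal norm, as a difference of positive
operators whose traces are the product of the norms of `(u + v) / √2` and `(u - v) / √2`. -/
lemma exists_ketbra_sub_ketbra_eq {u v a b : n → ℂ}
    (ha : a = ((1 / Real.sqrt 2 : ℝ) : ℂ) • (u + v)) (hb : b = ((1 / Real.sqrt 2 : ℝ) : ℂ) • (u - v))
    {r : ℝ} (hr : 0 ≤ r) (huv : r * (braket u u).re = r * (braket v v).re) :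
    ∃ P N : Matrix n n ℂ, P.PosSemidef ∧ N.PosSemidef ∧ r • ketbra u - r • ketbra v = P - N ∧
      P.trace.re = r * Real.sqrt ((braket a a).re * (braket b b).re) ∧
      N.trace.re = r * Real.sqrt ((braket a a).re * (braket b b).re) := by
  rcases hr.eq_or_lt with rfl | hr0
  · exact ⟨0, 0, .zero, .zero, by simp, by simp, by simp⟩
  have huv := mul_left_cancel₀ hr0.ne' huv
  have hs : (1 / Real.sqrt 2) * (1 / Real.sqrt 2) = (1 / 2 : ℝ) := by
    rw [div_mul_div_comm, Real.mul_self_sqrt (by norm_num), one_mul]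
  have hab : (braket a b).re = 0 := by
    have : (braket a b).re =
        (1 / Real.sqrt 2) * (1 / Real.sqrt 2) * ((braket u u).re - (braket v v).re) := by
      rw [braket_self_re, braket_self_re, ← Finset.sum_sub_distrib, Finset.mul_sum, ha, hb, braket,
        dotProduct, Complex.re_sum]
      refine Finset.sum_congr rfl fun i _ => ?_
      simp [-one_div, Complex.normSq_apply]
      ring
    rw [this, huv, sub_self, mul_zero]
  have hcross : ketbra u - ketbra v = Matrix.vecMulVec a (star b) + Matrix.vecMulVec b (star a) := by
    have hs' : (((1 / Real.sqrt 2 : ℝ) : ℂ)) * ((1 / Real.sqrt 2 : ℝ) : ℂ) = 1 / 2 := by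
      rw [← Complex.ofReal_mul, hs]
      simp
    ext i j
    simp only [ha, hb, ketbra, Matrix.sub_apply, Matrix.add_apply, Matrix.vecMulVec_apply,
      Pi.star_apply, Pi.smul_apply, Pi.add_apply, Pi.sub_apply, smul_eq_mul, star_mul', star_add,
      star_sub, RCLike.star_def, Complex.conj_ofReal]
    linear_combination (-2 * (u i * (starRingEnd ℂ) (u j) - v i * (starRingEnd ℂ) (v j))) * hs'
  set α := (braket a a).re with hα
  set β := (braket b b).re with hβ
  have hα0 : 0 ≤ α := braket_self_re_nonneg a
  have hβ0 : 0 ≤ β := braket_self_re_nonneg b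
  -- If `a` or `b` vanishes, so does the cross term, and the scale `c` below would divide by zero.
  rcases hα0.eq_or_lt with h0 | hα1
  · have ha0 : a = 0 := eq_zero_of_braket_self_re_eq_zero h0.symm
    refine ⟨0, 0, .zero, .zero, ?_, by simp [← h0], by simp [← h0]⟩
    rw [← smul_sub, hcross, ha0]
    simp
  rcases hβ0.eq_or_lt with h0 | hβ1
  · have hb0 : b = 0 := eq_zero_of_braket_self_re_eq_zero h0.symm
    refine ⟨0, 0, .zero, .zero, ?_, by simp [← h0], by simp [← h0]⟩
    rw [← smul_sub, hcross, hb0]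
    simp
  have hα2 := Real.sqrt_pos.2 hα1
  have hβ2 := Real.sqrt_pos.2 hβ1
  have hα3 := Real.sq_sqrt hα0
  have hβ3 := Real.sq_sqrt hβ0
  -- The projectors onto `√β a ± √α b` differ by `2√(αβ)` times the cross term, which fixes `c`.
  -- Both vectors have squared norm `2αβ` because `Re⟨a|b⟩ = 0`.
  set c : ℝ := r / (2 * (Real.sqrt α * Real.sqrt β)) with hc
  have hc0 : 0 ≤ c := by positivity
  have hcr : c * (2 * (Real.sqrt α * Real.sqrt β)) = r := by
    rw [hc]
    field_simp
  have htr : c * (Real.sqrt β ^ 2 * α + Real.sqrt α ^ 2 * β) = r * Real.sqrt (α * β) := by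
    rw [Real.sqrt_mul hα0, ← hcr, ← hα3, ← hβ3]
    simp only [Real.sqrt_sq hα2.le, Real.sqrt_sq hβ2.le]
    ring
  refine ⟨c • ketbra (Real.sqrt β • a + Real.sqrt α • b),
    c • ketbra (Real.sqrt β • a + (-Real.sqrt α) • b), (posSemidef_ketbra _).smul hc0,
    (posSemidef_ketbra _).smul hc0, ?_, ?_, ?_⟩
  · rw [← smul_sub, hcross, ← hcr]
    ext i j
    simp only [ketbra, Matrix.sub_apply, Matrix.add_apply, Matrix.vecMulVec_apply, Matrix.smul_apply,
      Pi.star_apply, Pi.smul_apply, Pi.add_apply, star_add, star_mul', RCLike.star_def,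
      Complex.conj_ofReal, Complex.real_smul]
    push_cast
    ring
  · rw [Matrix.trace_smul, Complex.smul_re, trace_ketbra_re, braket_add_self_re hab, smul_eq_mul,
      ← hα, ← hβ, htr]
  · rw [Matrix.trace_smul, Complex.smul_re, trace_ketbra_re, braket_add_self_re hab, smul_eq_mul,
      ← hα, ← hβ, neg_sq, htr]

end Vectors

/-! ### The server's conditional states -/

namespace Attack

variable {κ : Type*} [Fintype κ] [DecidableEq κ] (𝒜 : Attack κ)

/-- The component of the attacked state along the message `-1`. -/
noncomputable def outMinus (v : Fin 2 × Fin 2 → ℂ) : Sys κ → ℂ := fun w => 𝒜.out v (w, -1)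

/-- The unnormalized state of the server given `A`'s bit and the message `-1`, scaled by
`1 / p_a`. -/
noncomputable def serverState (i : Fin 2) : Matrix (Sys κ) (Sys κ) ℂ :=
  ∑ j, (𝒜.p i j / 𝒜.pa) • ketbra (𝒜.outMinus (ket (i, j)))

lemma out_smul (c : ℂ) (v : Fin 2 × Fin 2 → ℂ) : 𝒜.out (c • v) = c • 𝒜.out v := by
  rw [out, out, ← Matrix.mulVec_smul]
  congr 1
  ext x
  simp [tens, mul_assoc]

lemma out_add (v w : Fin 2 × Fin 2 → ℂ) : 𝒜.out (v + w) = 𝒜.out v + 𝒜.out w := by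
  rw [out, out, out, ← Matrix.mulVec_add]
  congr 1
  ext x
  simp [tens, add_mul]

lemma out_sub (v w : Fin 2 × Fin 2 → ℂ) : 𝒜.out (v - w) = 𝒜.out v - 𝒜.out w := by
  rw [sub_eq_add_neg, ← neg_one_smul ℂ w, out_add, out_smul, neg_one_smul, ← sub_eq_add_neg]

lemma outMinus_smul_add (c : ℂ) (v w : Fin 2 × Fin 2 → ℂ) :
    𝒜.outMinus (c • (v + w)) = c • (𝒜.outMinus v + 𝒜.outMinus w) := by
  ext x
  simp [outMinus, out_smul, out_add, mul_add]

lemma outMinus_smul_sub (c : ℂ) (v w : Fin 2 × Fin 2 → ℂ) :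
    𝒜.outMinus (c • (v - w)) = c • (𝒜.outMinus v - 𝒜.outMinus w) := by
  ext x
  simp [outMinus, out_smul, out_sub, mul_sub]

lemma braket_out_self (v : Fin 2 × Fin 2 → ℂ) : braket (𝒜.out v) (𝒜.out v) = braket v v := by
  rw [out, braket_mulVec_of_unitary 𝒜.U_unitary, braket_tens, braket_tens, 𝒜.zeroC_unit,
    𝒜.zeroCl_unit, mul_one, mul_one]

/-- The attack is an isometry, and keeping one value of the message discards the other nonnegative
contribution to the norm. -/
lemma braket_outMinus_self_re_le (v : Fin 2 × Fin 2 → ℂ) :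
    (braket (𝒜.outMinus v) (𝒜.outMinus v)).re ≤ (braket v v).re := by
  rw [← 𝒜.braket_out_self v, braket_self_re, braket_self_re,
    Fintype.sum_prod_type (f := fun x : Sys κ × ℤˣ => Complex.normSq (𝒜.out v x))]
  exact Finset.sum_le_sum fun w _ => Finset.single_le_sum
    (f := fun s => Complex.normSq (𝒜.out v (w, s))) (fun s _ => Complex.normSq_nonneg _)
    (Finset.mem_univ (-1))

lemma p_nonneg (i j : Fin 2) : 0 ≤ 𝒜.p i j :=
  (Complex.le_def.1 (𝒜.init_posSemidef.diag_nonneg (i := (i, j)))).1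

lemma projMinus_apply (k l : Fin 2 × Fin 2) (w w' : Sys κ) :
    𝒜.projMinus (k, w) (l, w') =
      if k = l then (𝒜.p k.1 k.2 : ℂ) * ketbra (𝒜.outMinus (ket k)) w w' else 0 := by
  have h : 𝒜.projMinus (k, w) (l, w') = ∑ q : Fin 2 × Fin 2, (𝒜.p q.1 q.2 : ℂ) *
      ((ket q k * star (ket q l)) * ketbra (𝒜.outMinus (ket q)) w w') := by
    rw [Fintype.sum_prod_type]
    simp [projMinus, rhoABC, Matrix.sum_apply, ketbra, Matrix.vecMulVec_apply, outMinus]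
  rw [h, Finset.sum_eq_single k]
  · by_cases hkl : k = l
    · subst hkl
      simp [ket]
    · simp [ket, hkl, Ne.symm hkl]
  · intro q _ hq
    simp [ket, Pi.single_apply, hq.symm]
  · simp

lemma probMinusAnd_eq (i j : Fin 2) : 𝒜.probMinusAnd i j =
    𝒜.p i j * (braket (𝒜.outMinus (ket (i, j))) (𝒜.outMinus (ket (i, j)))).re := by
  simp only [probMinusAnd, projMinus_apply, if_true, ← Finset.mul_sum, Complex.re_ofReal_mul]
  rw [← trace_ketbra_re]
  rfl

lemma pa_eq : 𝒜.pa = ∑ i, ∑ j, 𝒜.probMinusAnd i j := by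
  simp only [pa, Matrix.trace, Fintype.sum_prod_type, Complex.re_sum, probMinusAnd,
    Matrix.diag_apply]

lemma re_trace_serverState (i : Fin 2) :
    (𝒜.serverState i).trace.re = (∑ j, 𝒜.probMinusAnd i j) / 𝒜.pa := by
  simp only [serverState, Matrix.trace_sum, Matrix.trace_smul, Complex.re_sum, Complex.smul_re,
    trace_ketbra_re, probMinusAnd_eq, Finset.sum_div, smul_eq_mul]
  exact Finset.sum_congr rfl fun j _ => by ring

lemma posSemidef_serverState (hpa : 0 < 𝒜.pa) (i : Fin 2) : (𝒜.serverState i).PosSemidef :=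
  Matrix.posSemidef_sum _ fun j _ =>
    (posSemidef_ketbra _).smul (div_nonneg (𝒜.p_nonneg i j) hpa.le)

lemma rhoAC'_apply (i i' : Fin 2) (w w' : Sys κ) :
    𝒜.rhoAC' (i, w) (i', w') = if i = i' then 𝒜.serverState i w w' else 0 := by
  simp only [rhoAC', rhoABC', Matrix.smul_apply, projMinus_apply, Prod.mk.injEq, and_true]
  by_cases h : i = i'
  · simp only [h, if_true, serverState, Matrix.sum_apply, Matrix.smul_apply, Complex.real_smul,
      smul_eq_mul]
    refine Finset.sum_congr rfl fun j _ => ?_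
    push_cast
    ring
  · simp [h]

lemma rhoAC'_eq : 𝒜.rhoAC' =
    Matrix.reindex (Equiv.prodComm _ _) (Equiv.prodComm _ _)
      (Matrix.blockDiagonal 𝒜.serverState) := by
  ext ⟨i, w⟩ ⟨i', w'⟩
  rw [rhoAC'_apply]
  simp [Matrix.blockDiagonal_apply]

lemma traceFst_rhoAC' : traceFst 𝒜.rhoAC' = 𝒜.serverState 0 + 𝒜.serverState 1 := by
  ext w w'
  simp [traceFst, rhoAC'_apply]

lemma traceSnd_rhoAC' (hpa : 0 < 𝒜.pa) : traceSnd 𝒜.rhoAC' =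
    Matrix.diagonal fun i => (((𝒜.serverState i).trace.re : ℝ) : ℂ) := by
  ext i i'
  rw [Matrix.diagonal_apply]
  by_cases h : i = i'
  · subst h
    simp only [traceSnd, rhoAC'_apply, if_true]
    have h := (𝒜.posSemidef_serverState hpa i).trace_nonneg
    exact Complex.eq_re_of_ofReal_le (r := 0) (by rwa [Complex.ofReal_zero])
  · simp [traceSnd, rhoAC'_apply, h]

lemma isHermitian_rhoAC' (hpa : 0 < 𝒜.pa) : 𝒜.rhoAC'.IsHermitian := by
  have h : (Matrix.blockDiagonal 𝒜.serverState).IsHermitian := by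
    rw [Matrix.IsHermitian, Matrix.blockDiagonal_conjTranspose]
    congr 1
    ext1 i
    exact (𝒜.posSemidef_serverState hpa i).1
  rw [rhoAC'_eq]
  exact h.submatrix _

lemma traceXLogX_rhoAC' :
    traceXLogX 𝒜.rhoAC' = traceXLogX (𝒜.serverState 0) + traceXLogX (𝒜.serverState 1) := by
  have h : traceXLogX 𝒜.rhoAC' = traceXLogX (Matrix.blockDiagonal 𝒜.serverState) := by
    simp only [traceXLogX, spectralSum, rhoAC'_eq, Matrix.charpoly_reindex]
  rw [h, traceXLogX, spectralSum_blockDiagonal, Fin.sum_univ_two]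
  rfl

/-- The traces 1/2 make the bit of `A` uniform, which contributes the term `Real.log 2`. -/
lemma infoAC_eq (hpa : 0 < 𝒜.pa) (h0 : (𝒜.serverState 0).trace.re = 1 / 2)
    (h1 : (𝒜.serverState 1).trace.re = 1 / 2) :
    𝒜.infoAC = (traceXLogX (𝒜.serverState 0) + traceXLogX (𝒜.serverState 1) -
      traceXLogX (𝒜.serverState 0 + 𝒜.serverState 1) + Real.log 2) / Real.log 2 := by
  have hA : traceXLogX (traceSnd 𝒜.rhoAC') = -Real.log 2 := by
    rw [traceSnd_rhoAC' 𝒜 hpa, traceXLogX, spectralSum_of_charpoly (Matrix.charpoly_diagonal _),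
      Fin.sum_univ_two, h0, h1, one_div, Real.log_inv]
    ring
  have hA' : (traceSnd 𝒜.rhoAC').IsHermitian := by
    rw [traceSnd_rhoAC' 𝒜 hpa]
    exact Matrix.isHermitian_diagonal_of_self_adjoint _ (by ext i; simp)
  have hC := ((𝒜.posSemidef_serverState hpa 0).add (𝒜.posSemidef_serverState hpa 1)).1
  rw [infoAC, mutualInformation, vonNeumannEntropy_eq hA', traceFst_rhoAC',
    vonNeumannEntropy_eq hC, vonNeumannEntropy_eq (𝒜.isHermitian_rhoAC' hpa), hA,
    traceXLogX_rhoAC']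
  ring

lemma braket_bell_self_re (i : Fin 4) : (braket (bell i) (bell i)).re = 1 := by
  have hs : Real.sqrt 2 / 2 * (Real.sqrt 2 / 2) = 1 / 2 := by
    rw [div_mul_div_comm, Real.mul_self_sqrt (by norm_num)]
    norm_num
  rw [braket_self_re, Fintype.sum_prod_type]
  fin_cases i <;> simp [bell, ket, Complex.normSq_apply, Pi.single_apply] <;> linarith

end Attack

end MediatedSQKD

/-! ### Assembly for symmetric attacks -/

theorem theorem1 {κ : Type*} [Fintype κ] [DecidableEq κ] (𝒜 : MediatedSQKD.Attack κ)
    (e f : Fin 4 → (MediatedSQKD.Sys κ → ℂ))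
    (hef : ∀ i : Fin 4, 𝒜.out (MediatedSQKD.bell i) =
      MediatedSQKD.tens (e i) (MediatedSQKD.ket (1 : ℤˣ)) +
        MediatedSQKD.tens (f i) (MediatedSQKD.ket (-1 : ℤˣ)))
    (Q : ℝ)
    (h00 : 𝒜.p 0 0 = (1 - Q) / 2) (h11 : 𝒜.p 1 1 = (1 - Q) / 2)
    (h01 : 𝒜.p 0 1 = Q / 2) (h10 : 𝒜.p 1 0 = Q / 2)
    (hsame : 𝒜.probMinusGiven 0 0 = 𝒜.probMinusGiven 1 1)
    (hdiff : 𝒜.probMinusGiven 0 1 = 𝒜.probMinusGiven 1 0)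
    (hpa : 0 < 𝒜.pa) :
    (𝒜.infoAC ≤
      (1 - Q) / 𝒜.pa * Real.sqrt ((MediatedSQKD.braket (f 0) (f 0)).re *
          (MediatedSQKD.braket (f 1) (f 1)).re) +
        Q / 𝒜.pa * Real.sqrt ((MediatedSQKD.braket (f 2) (f 2)).re *
          (MediatedSQKD.braket (f 3) (f 3)).re)) ∧
    (∀ i : Fin 4, (MediatedSQKD.braket (f i) (f i)).re ≤ 1) ∧
    ((1 - Q) / 𝒜.pa * Real.sqrt ((MediatedSQKD.braket (f 0) (f 0)).re *
          (MediatedSQKD.braket (f 1) (f 1)).re) +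
        Q / 𝒜.pa * Real.sqrt ((MediatedSQKD.braket (f 2) (f 2)).re *
          (MediatedSQKD.braket (f 3) (f 3)).re) ≤
      (1 - Q) / 𝒜.pa * Real.sqrt (MediatedSQKD.braket (f 0) (f 0)).re + Q / 𝒜.pa) := by
  open MediatedSQKD in
  have hf : ∀ i, f i = 𝒜.outMinus (bell i) := by
    intro i
    ext w
    have h1 : (-1 : ℤˣ) ≠ 1 := by decide
    simp [Attack.outMinus, hef, tens, ket, h1]
  have hf1 : ∀ i : Fin 4, (braket (f i) (f i)).re ≤ 1 := fun i => by
    rw [hf, ← Attack.braket_bell_self_re i]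
    exact 𝒜.braket_outMinus_self_re_le _
  have hQ0 : 0 ≤ Q := by
    have := 𝒜.p_nonneg 0 1
    linarith
  have hQ1 : 0 ≤ 1 - Q := by
    have := 𝒜.p_nonneg 0 0
    linarith
  refine ⟨?_, hf1, ?_⟩
  -- Joint probabilities agree even when the conditioning event has probability zero: both products
  -- are then 0, whatever the default value of the quotient.
  · have cancel : ∀ {a b q : ℝ}, q * a / q = q * b / q → q * a = q * b := by
      intro a b q h
      by_cases hq : q = 0
      · simp [hq]
      · exact (div_left_inj' hq).1 h
    have hs : 𝒜.probMinusAnd 0 0 = 𝒜.probMinusAnd 1 1 := by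
      rw [Attack.probMinusGiven, Attack.probMinusGiven, Attack.probMinusAnd_eq,
        Attack.probMinusAnd_eq, h00, h11] at hsame
      rw [Attack.probMinusAnd_eq, Attack.probMinusAnd_eq, h00, h11]
      exact cancel hsame
    have hd : 𝒜.probMinusAnd 0 1 = 𝒜.probMinusAnd 1 0 := by
      rw [Attack.probMinusGiven, Attack.probMinusGiven, Attack.probMinusAnd_eq,
        Attack.probMinusAnd_eq, h01, h10] at hdiff
      rw [Attack.probMinusAnd_eq, Attack.probMinusAnd_eq, h01, h10]
      exact cancel hdiff
    have hpa' := 𝒜.pa_eq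
    simp only [Fin.sum_univ_two] at hpa'
    have t0 : (𝒜.serverState 0).trace.re = 1 / 2 := by
      rw [Attack.re_trace_serverState, Fin.sum_univ_two, div_eq_iff hpa.ne']
      linarith
    have t1 : (𝒜.serverState 1).trace.re = 1 / 2 := by
      rw [Attack.re_trace_serverState, Fin.sum_univ_two, div_eq_iff hpa.ne']
      linarith
    rw [Attack.probMinusAnd_eq, Attack.probMinusAnd_eq, h00, h11] at hs
    rw [Attack.probMinusAnd_eq, Attack.probMinusAnd_eq, h01, h10] at hd
    obtain ⟨P, N, hP, hN, hPN, trP, trN⟩ := exists_ketbra_sub_ketbra_eq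
      (u := 𝒜.outMinus (ket (0, 0))) (v := 𝒜.outMinus (ket (1, 1))) (a := f 0) (b := f 1)
      (by rw [hf, ← Attack.outMinus_smul_add]; rfl) (by rw [hf, ← Attack.outMinus_smul_sub]; rfl)
      (r := (1 - Q) / 2 / 𝒜.pa) (by positivity)
      (by rw [div_mul_eq_mul_div _ 𝒜.pa, hs, div_mul_eq_mul_div _ 𝒜.pa])
    obtain ⟨P', N', hP', hN', hPN', trP', trN'⟩ := exists_ketbra_sub_ketbra_eq
      (u := 𝒜.outMinus (ket (0, 1))) (v := 𝒜.outMinus (ket (1, 0))) (a := f 2) (b := f 3)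
      (by rw [hf, ← Attack.outMinus_smul_add]; rfl) (by rw [hf, ← Attack.outMinus_smul_sub]; rfl)
      (r := Q / 2 / 𝒜.pa) (by positivity)
      (by rw [div_mul_eq_mul_div _ 𝒜.pa, hd, div_mul_eq_mul_div _ 𝒜.pa])
    -- The two pairs are matched across the bit of `A`: 00 with 11 and 01 with 10.
    have hdec : 𝒜.serverState 0 - 𝒜.serverState 1 = (P + P') - (N + N') := by
      rw [add_sub_add_comm, ← hPN, ← hPN']
      simp only [Attack.serverState, Fin.sum_univ_two, h00, h01, h10, h11]
      abel
    have main := traceXLogX_add_le (𝒜.posSemidef_serverState hpa 0)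
      (𝒜.posSemidef_serverState hpa 1) (hP.add hP') (hN.add hN') hdec
    rw [Attack.infoAC_eq 𝒜 hpa t0 t1, div_le_iff₀ (Real.log_pos one_lt_two)]
    simp only [t0, t1, Matrix.trace_add, Complex.add_re, trP, trP', trN, trN'] at main
    refine le_trans (le_of_eq ?_) (main.trans (le_of_eq ?_)) <;> ring
  · refine add_le_add (mul_le_mul_of_nonneg_left (Real.sqrt_le_sqrt ?_) (by positivity)) ?_
    · exact mul_le_of_le_one_right (braket_self_re_nonneg _) (hf1 1)
    · refine mul_le_of_le_one_right (by positivity) (Real.sqrt_le_one.2 ?_)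
      exact mul_le_one₀ (hf1 2) (braket_self_re_nonneg _) (hf1 3)
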